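/- For a number field $K$ with ring of integers $\mathbb{Z}_K$, let the index of $K$ be $$i(K)=\gcd\{(\mathbb{Z}_K:\mathbb{Z}[\theta]) \mid \theta\in\mathbb{Z}_K,\ K=\mathbb{Q}(\theta)\}.$$ Let $p\ge 5$ be a prime number and let $a,b\in\mathbb{Z}$ be such that the polynomial $x^9+ax+b$ is irreducible. Let $K=\mathbb{Q}(\alpha)$ be the number field generated by a root $\alpha$ of $x^9+ax+b$. Then $p$ does not divide $i(K)$. -/

import Mathlib

open Polynomial IntermediateField

namespace NumberField

/-- The index `(𝓞 K : ℤ[θ])`, as the index of the additive subgroup `ℤ[θ]` of `𝓞 K`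
(with the convention that an infinite index is `0`; it is finite when `K = ℚ(θ)`). -/
noncomputable def elementIndex (K : Type*) [Field K] [NumberField K] (θ : 𝓞 K) : ℕ :=
  (Subalgebra.toSubmodule (Algebra.adjoin ℤ {θ})).toAddSubgroup.index

/-- The set of indices `(𝓞 K : ℤ[θ])` of all `θ ∈ 𝓞 K` such that `K = ℚ(θ)`. -/
def indexSet (K : Type*) [Field K] [NumberField K] : Set ℕ :=
  {n | ∃ θ : 𝓞 K, ℚ⟮(θ : K)⟯ = ⊤ ∧ elementIndex K θ = n}

/-- The index `i(K)` of a number field: the greatest common divisor of the indices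
`(𝓞 K : ℤ[θ])` of all integral primitive elements `θ` of `K`. -/
noncomputable def fieldIndex (K : Type*) [Field K] [NumberField K] : ℕ :=
  sSup {d : ℕ | ∀ n ∈ indexSet K, d ∣ n}

end NumberField

/-! ### Factorization of `p` and norms in Dedekind domains. -/

section DedekindNorm

variable {R : Type*} [CommRing R] [IsDedekindDomain R]

/-! It suffices to find one primitive integral θ of index prime to p. Let p = ∏ P^e(P) with residue
degrees f(P). Given distinct monic irreducible g_P over 𝔽_p of degree f(P), with integral lifts G_P,
the Chinese remainder theorem yields θ such that each G_P(θ) is exactly divisible by P. Every H with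
H(θ) ∈ (p) is then divisible mod p by ∏ g_P^e(P), of degree ∑ e f = [K : ℚ], which forces p ∤ (ℤ_K :
ℤ[θ]) (`exists_forall_aeval_mem_span_imp_dvd`, `not_dvd_elementIndex`).

Translates g(X + c) give p irreducibles in each degree prime to p, and every positive degree has at
least one. As ∑ e f = 9 and p ≥ 5, the only possible obstruction is more than p primes of residue
degree 1 (`card_filter_eq_one_le`).

Let F = x⁹ + ax + b. If p does not divide both a and b, then k primes of degree 1 with α ≡ r force
p^k ∣ F(r) at every lift of r. Hence k ≤ 2, at most one class has k = 2, and in that case the class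
0 is empty (`card_le_of_not_dvd`). If p ∣ a and p ∣ b, one replaces α by α/p while p⁸ ∣ a and p⁹ ∣
b; when this stops with p still dividing both, a Newton polygon argument leaves at most five primes
above p (`card_le_five_of_dvd`). -/

lemma isCoprime_pow_of_prime_ne {P Q : Ideal R} (hP : Prime P) (hQ : Prime Q) (h : P ≠ Q)
    (m n : ℕ) : IsCoprime (P ^ m) (Q ^ n) := by
  have := IsDedekindDomain.HeightOneSpectrum.isCoprime_pow_of_ne
    ⟨P, Ideal.isPrime_of_prime hP, hP.ne_zero⟩ ⟨Q, Ideal.isPrime_of_prime hQ, hQ.ne_zero⟩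
    (by simpa [IsDedekindDomain.HeightOneSpectrum.ext_iff] using h) m n
  exact this

variable [Module.Free ℤ R] [Module.Finite ℤ R]

/-- The factorization of `p` in a Dedekind domain of finite rank over `ℤ`, with ramification
indices `e`, residue degrees `f` and the fundamental identity `∑ e f = n`. -/
theorem exists_factorization_span_prime (R : Type*) [CommRing R] [IsDedekindDomain R]
    [Module.Free ℤ R] [Module.Finite ℤ R] {p : ℕ} (hp : p.Prime) :
    ∃ (T : Finset (Ideal R)) (e f : Ideal R → ℕ),
      (∀ P ∈ T, Prime P ∧ 0 < e P ∧ 0 < f P ∧ Ideal.absNorm P = p ^ f P ∧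
        emultiplicity P (Ideal.span {(p : R)}) = e P) ∧
      Ideal.span {(p : R)} = ∏ P ∈ T, P ^ e P ∧
      ∑ P ∈ T, e P * f P = Module.finrank ℤ R := by
  classical
  set I : Ideal R := Ideal.span {(p : R)} with hI
  have hnorm : Ideal.absNorm I = p ^ Module.finrank ℤ R := by
    rw [hI, Ideal.absNorm_span_singleton]
    have := Algebra.norm_algebraMap (R := ℤ) (S := R) (p : ℤ)
    simp only [map_natCast] at this
    rw [this]
    simp [Int.natAbs_pow]
  have hI0 : I ≠ ⊥ := by
    intro h
    rw [h, Ideal.absNorm_bot] at hnorm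
    exact (pow_pos hp.pos _).ne hnorm
  let F := UniqueFactorizationMonoid.normalizedFactors I
  have hprod : ∏ P ∈ F.toFinset, P ^ F.count P = I := by
    rw [← Finset.prod_multiset_count]
    exact Ideal.prod_normalizedFactors_eq_self hI0
  have hprime : ∀ P ∈ F.toFinset, Prime P := fun P hP ↦
    UniqueFactorizationMonoid.prime_of_normalized_factor P (Multiset.mem_toFinset.1 hP)
  have hex : ∀ P ∈ F.toFinset, ∃ k, 0 < k ∧ Ideal.absNorm P = p ^ k := by
    intro P hP
    have hd : P ∣ I := UniqueFactorizationMonoid.dvd_of_mem_normalizedFactors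
      (Multiset.mem_toFinset.1 hP)
    have h1 : Ideal.absNorm P ∣ p ^ Module.finrank ℤ R := hnorm ▸ map_dvd Ideal.absNorm hd
    obtain ⟨k, -, hk⟩ := (Nat.dvd_prime_pow hp).1 h1
    refine ⟨k, Nat.pos_of_ne_zero ?_, hk⟩
    rintro rfl
    rw [pow_zero, Ideal.absNorm_eq_one_iff] at hk
    exact (hprime P hP).not_isUnit (Ideal.isUnit_iff.2 hk)
  choose! f hf0 hf using hex
  refine ⟨F.toFinset, fun P ↦ F.count P, f, ?_, hprod.symm, ?_⟩
  · intro P hP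
    refine ⟨hprime P hP, Multiset.count_pos.2 (Multiset.mem_toFinset.1 hP), hf0 P hP, hf P hP, ?_⟩
    rw [UniqueFactorizationMonoid.emultiplicity_eq_count_normalizedFactors
      (hprime P hP).irreducible hI0, normalize_eq]
  · apply Nat.pow_right_injective hp.two_le
    change p ^ _ = p ^ _
    rw [← hnorm, ← hprod, map_prod, ← Finset.prod_pow_eq_pow_sum]
    refine Finset.prod_congr rfl fun P hP ↦ ?_
    rw [map_pow, hf P hP, ← pow_mul, mul_comm]

/-- If `x` lies in `P ^ k P` for distinct primes `P` of norm `p ^ f P`, then `p ^ ∑ k f` divides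
the norm of `x`. -/
theorem pow_sum_dvd_norm {p : ℕ} {T : Finset (Ideal R)} {f k : Ideal R → ℕ}
    (hT : ∀ P ∈ T, Prime P) (hf : ∀ P ∈ T, Ideal.absNorm P = p ^ f P) {x : R}
    (hx : ∀ P ∈ T, x ∈ P ^ k P) :
    ((p ^ ∑ P ∈ T, k P * f P : ℕ) : ℤ) ∣ Algebra.norm ℤ x := by
  rw [Int.natCast_dvd, ← Ideal.absNorm_span_singleton]
  have h : ∏ P ∈ T, P ^ k P ∣ Ideal.span {x} :=
    Finset.prod_dvd_of_coprime
      (fun P hP Q hQ h ↦ isCoprime_pow_of_prime_ne (hT P hP) (hT Q hQ) h _ _)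
      (fun P hP ↦ Ideal.dvd_span_singleton.2 (hx P hP))
  have h2 := map_dvd Ideal.absNorm h
  rw [map_prod] at h2
  rw [← Finset.prod_pow_eq_pow_sum]
  rwa [Finset.prod_congr rfl fun P hP ↦ by rw [map_pow, hf P hP, ← pow_mul, mul_comm]] at h2

end DedekindNorm

/-! ### Irreducible polynomials over 𝔽_p and their translates. -/

section FiniteFieldPolynomials

variable {p : ℕ} [Fact p.Prime]

lemma ZMod.exists_monic_irreducible_natDegree (p : ℕ) [Fact p.Prime] {d : ℕ} (hd : d ≠ 0) :
    ∃ g : (ZMod p)[X], g.Monic ∧ Irreducible g ∧ g.natDegree = d := by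
  obtain ⟨b, hb⟩ := Field.exists_primitive_element (ZMod p) (GaloisField p d)
  have hi : IsIntegral (ZMod p) b := Algebra.IsIntegral.isIntegral b
  refine ⟨minpoly (ZMod p) b, minpoly.monic hi, minpoly.irreducible hi, ?_⟩
  rw [← IntermediateField.adjoin.finrank hi, hb, IntermediateField.finrank_top',
    GaloisField.finrank p hd]

lemma Polynomial.coeff_taylor_natDegree_sub_one {A : Type*} [CommRing A] {g : A[X]}
    (hg : g.Monic) (hd : g.natDegree ≠ 0) (c : A) :
    (taylor c g).coeff (g.natDegree - 1) = g.coeff (g.natDegree - 1) + g.natDegree * c := by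
  obtain ⟨d, hd'⟩ := Nat.exists_eq_succ_of_ne_zero hd
  have hdeg : (hasseDeriv d g).natDegree ≤ 1 := by
    refine (natDegree_hasseDeriv_le g d).trans ?_
    omega
  have hlc : g.coeff (1 + d) = 1 := by
    rw [show 1 + d = g.natDegree by omega]; exact hg
  rw [hd', Nat.succ_sub_one, taylor_coeff, eq_X_add_C_of_natDegree_le_one hdeg]
  simp only [hasseDeriv_coeff, eval_add, eval_mul, eval_C, eval_X, hlc]
  simp [add_comm 1 d]
  ring

/-- Translation by c adds deg(g)·c to the second-highest coefficient, and deg(g) is invertible mod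
p. -/
lemma Polynomial.taylor_left_injective {g : (ZMod p)[X]} (hg : g.Monic)
    (hd : ¬ p ∣ g.natDegree) : Function.Injective fun c : ZMod p ↦ taylor c g := by
  intro c c' h
  have hd0 : g.natDegree ≠ 0 := by
    intro h0
    exact hd (h0 ▸ dvd_zero p)
  have h1 := congrArg (fun q ↦ coeff q (g.natDegree - 1)) h
  simp only [coeff_taylor_natDegree_sub_one hg hd0, add_right_inj] at h1
  exact mul_left_cancel₀ (by rwa [Ne, ZMod.natCast_eq_zero_iff]) h1

lemma Polynomial.irreducible_taylor {A : Type*} [CommRing A] {g : A[X]} (hg : Irreducible g)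
    (c : A) : Irreducible (taylor c g) := by
  exact (MulEquiv.irreducible_iff (taylorEquiv c)).2 hg

end FiniteFieldPolynomials

lemma Polynomial.C_natCast_dvd_of_map_eq_zero {p : ℕ} {H : ℤ[X]}
    (hH : H.map (Int.castRingHom (ZMod p)) = 0) : C (p : ℤ) ∣ H := by
  rw [C_dvd_iff_dvd_coeff]
  intro i
  have := congrArg (fun q ↦ coeff q i) hH
  simpa only [coeff_map, eq_intCast, coeff_zero, ZMod.intCast_zmod_eq_zero_iff_dvd] using this

/-! ### Polynomial values at a prime above p. -/

section ResidueField

variable {R : Type*} [CommRing R] [IsDedekindDomain R] [Module.Free ℤ R]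
variable {p : ℕ} [Fact p.Prime]

lemma card_quotient_eq_absNorm (P : Ideal R) : Nat.card (R ⧸ P) = Ideal.absNorm P := by
  rw [Ideal.absNorm_apply, Submodule.cardQuot_apply]

variable [Module.Finite ℤ R]

lemma charP_quotient_of_absNorm {P : Ideal R} (hP : Prime P) {f : ℕ}
    (hf : Ideal.absNorm P = p ^ f) : CharP (R ⧸ P) p := by
  have := Ideal.isPrime_of_prime hP
  have : Finite (R ⧸ P) := Ideal.finiteQuotientOfFreeOfNeBot P hP.ne_zero
  let := Fintype.ofFinite (R ⧸ P)
  refine charP_of_card_eq_prime_pow (f := f) ?_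
  rw [← Nat.card_eq_fintype_card, card_quotient_eq_absNorm, hf]

/-- An irreducible polynomial over `𝔽_p` of degree `f` has a lift of a root modulo a prime `P` of
residue degree `f` at which its value is exactly divisible by `P`. -/
theorem exists_aeval_mem_notMem_sq {P : Ideal R} (hP : Prime P) {f : ℕ}
    (hf : Ideal.absNorm P = p ^ f) {G : ℤ[X]}
    (hG : Irreducible (G.map (Int.castRingHom (ZMod p))))
    (hdeg : (G.map (Int.castRingHom (ZMod p))).natDegree = f) :
    ∃ x : R, aeval x G ∈ P ∧ aeval x G ∉ P ^ 2 := by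
  have := Ideal.isPrime_of_prime hP
  have hmax : P.IsMaximal := Ideal.IsPrime.isMaximal this hP.ne_zero
  have : Finite (R ⧸ P) := Ideal.finiteQuotientOfFreeOfNeBot P hP.ne_zero
  let := Fintype.ofFinite (R ⧸ P)
  let : Field (R ⧸ P) := Ideal.Quotient.field P
  have := charP_quotient_of_absNorm (p := p) hP hf
  let : Algebra (ZMod p) (R ⧸ P) := ZMod.algebra _ p
  set g := G.map (Int.castRingHom (ZMod p)) with hg
  have hmk : ∀ (x : R) (H : ℤ[X]), Ideal.Quotient.mk P (aeval x H) =
      aeval (Ideal.Quotient.mk P x) (H.map (Int.castRingHom (ZMod p))) := by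
    intro x H
    rw [← algebraMap_int_eq, aeval_map_algebraMap, ← Ideal.Quotient.algebraMap_eq,
      aeval_algebraMap_apply]
  have : Fact (Irreducible g) := ⟨hG⟩
  have : Module.Finite (ZMod p) (AdjoinRoot g) :=
    (AdjoinRoot.powerBasis hG.ne_zero).finite
  have : Finite (AdjoinRoot g) := Module.finite_of_finite (ZMod p)
  let := Fintype.ofFinite (AdjoinRoot g)
  have hcard : Fintype.card (AdjoinRoot g) = Fintype.card (R ⧸ P) := by
    rw [← Nat.card_eq_fintype_card, ← Nat.card_eq_fintype_card, card_quotient_eq_absNorm, hf,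
      Module.natCard_eq_pow_finrank (K := ZMod p), Nat.card_zmod,
      (AdjoinRoot.powerBasis hG.ne_zero).finrank, AdjoinRoot.powerBasis_dim, hdeg]
  -- Finite fields of equal cardinality are isomorphic, so g has a root in R/P.
  let φ := FiniteField.algEquivOfCardEq p hcard
  obtain ⟨x, hx⟩ := Ideal.Quotient.mk_surjective (φ (AdjoinRoot.root g))
  have hroot : aeval (Ideal.Quotient.mk P x) g = 0 := by
    rw [hx, ← AlgEquiv.coe_toAlgHom, aeval_algHom_apply, AdjoinRoot.aeval_eq, AdjoinRoot.mk_self,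
      map_zero]
  have hxP : aeval x G ∈ P := by
    rw [← Ideal.Quotient.eq_zero_iff_mem, hmk, hroot]
  by_cases hx2 : aeval x G ∈ P ^ 2
  -- Shifting x by y ∈ P ∖ P² changes G(x) by G'(x)y mod P², and G'(x) is a unit mod P by
  -- separability.
  · obtain ⟨y, hy, hy2⟩ := Ideal.exists_mem_pow_notMem_pow_succ P hP.ne_zero hmax.ne_top 1
    rw [pow_one] at hy
    have hder : aeval x (derivative G) ∉ P := by
      rw [← Ideal.Quotient.eq_zero_iff_mem, hmk, ← derivative_map]
      exact (PerfectField.separable_of_irreducible hG).aeval_derivative_ne_zero hroot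
    obtain ⟨k, hk⟩ := binomExpansion (G.map (algebraMap ℤ R)) x y
    simp only [derivative_map, eval_map_algebraMap] at hk
    have hky : k * y ^ 2 ∈ P ^ 2 := Ideal.mul_mem_left _ _ (Ideal.pow_mem_pow hy 2)
    refine ⟨x + y, ?_, fun h ↦ ?_⟩
    · rw [hk]
      exact P.add_mem (P.add_mem hxP (P.mul_mem_left _ hy)) (Ideal.pow_le_self two_ne_zero hky)
    · rw [hk, Ideal.add_mem_iff_left _ hky, Ideal.add_mem_iff_right _ hx2] at h
      rcases Ideal.IsPrime.mul_mem_pow P h with h | h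
      · exact hder h
      · exact hy2 h
  · exact ⟨x, hxP, hx2⟩

/-- If `G(x)` is exactly divisible by `P` with `G` irreducible mod `p`, then `H(x) ∈ P ^ e`
forces `G ^ e` to divide `H` mod `p`. -/
theorem map_pow_dvd_of_aeval_mem_pow {P : Ideal R} (hP : Prime P) {f : ℕ}
    (hf : Ideal.absNorm P = p ^ f) {G : ℤ[X]}
    (hG : Irreducible (G.map (Int.castRingHom (ZMod p)))) {x : R} (hx : aeval x G ∈ P)
    (hx2 : aeval x G ∉ P ^ 2) {e : ℕ} (hpe : (p : R) ∈ P ^ e) {H : ℤ[X]}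
    (hH : aeval x H ∈ P ^ e) :
    G.map (Int.castRingHom (ZMod p)) ^ e ∣ H.map (Int.castRingHom (ZMod p)) := by
  have := Ideal.isPrime_of_prime hP
  have := charP_quotient_of_absNorm (p := p) hP hf
  let : Algebra (ZMod p) (R ⧸ P) := ZMod.algebra _ p
  have hmk : ∀ (H : ℤ[X]), Ideal.Quotient.mk P (aeval x H) =
      aeval (Ideal.Quotient.mk P x) (H.map (Int.castRingHom (ZMod p))) := by
    intro H
    rw [← algebraMap_int_eq, aeval_map_algebraMap, ← Ideal.Quotient.algebraMap_eq,
      aeval_algebraMap_apply]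
  set g := G.map (Int.castRingHom (ZMod p)) with hg
  set h := H.map (Int.castRingHom (ZMod p)) with hh
  by_contra hnd
  have hfin : FiniteMultiplicity g h := ⟨e, fun h' ↦ hnd ((pow_dvd_pow g e.le_succ).trans h')⟩
  obtain ⟨u, hu, hgu⟩ := hfin.exists_eq_pow_mul_and_not_dvd
  set k := multiplicity g h
  have hke : k < e := by
    by_contra hke
    exact hnd ((pow_dvd_pow g (not_lt.1 hke)).trans ⟨u, hu⟩)
  obtain ⟨U, hU⟩ := Polynomial.map_surjective (Int.castRingHom (ZMod p))
    (ZMod.intCast_surjective) u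
  have hmap : (H - G ^ k * U).map (Int.castRingHom (ZMod p)) = 0 := by
    simp [Polynomial.map_sub, Polynomial.map_mul, Polynomial.map_pow, hU, ← hg, ← hh, hu.symm]
  -- H = G^k U + pW with U(x) prime to P and k < e, so H(x) has P-valuation exactly k, against H(x)
  -- ∈ P^e.
  obtain ⟨W, hW⟩ := C_natCast_dvd_of_map_eq_zero hmap
  have hUP : aeval x U ∉ P := by
    rw [← Ideal.Quotient.eq_zero_iff_mem, hmk, hU]
    intro h0
    obtain ⟨s, t, hst⟩ := (hG.coprime_iff_not_dvd.2 hgu : IsCoprime g u)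
    have hg0 : aeval (Ideal.Quotient.mk P x) g = 0 := by
      rw [← hmk, Ideal.Quotient.eq_zero_iff_mem]; exact hx
    have := congrArg (aeval (Ideal.Quotient.mk P x)) hst
    simp [hg0, h0] at this
  have hmem : aeval x G ^ k * aeval x U ∈ P ^ e := by
    have := congrArg (aeval x) hW
    simp only [map_sub, map_mul, map_pow, map_natCast] at this
    rw [show aeval x G ^ k * aeval x U = aeval x H - p * aeval x W by rw [← this]; ring]
    exact Ideal.sub_mem _ hH (Ideal.mul_mem_right _ _ hpe)
  have h1 : aeval x G ^ k ∈ P ^ (k + 1) := by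
    rw [mul_comm] at hmem
    exact Ideal.pow_le_pow_right hke ((Ideal.IsPrime.mul_mem_pow P hmem).resolve_left hUP)
  have hG1 : emultiplicity P (Ideal.span {aeval x G}) ≤ 1 := by
    by_contra! hlt
    exact hx2 (Ideal.dvd_span_singleton.1 (pow_dvd_of_le_emultiplicity
      (by simpa [one_add_one_eq_two] using Order.add_one_le_of_lt hlt)))
  have h2 := pow_dvd_iff_le_emultiplicity.1 (Ideal.dvd_span_singleton.2 h1)
  rw [← Ideal.span_singleton_pow, emultiplicity_pow hP] at h2
  have h3 := h2.trans (mul_le_mul_right hG1 (k : ℕ∞))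
  rw [mul_one] at h3
  norm_cast at h3
  omega

end ResidueField

/-! ### Construction of a generator modulo p. -/

section MonogenicModP

variable {R : Type*} [CommRing R] [IsDedekindDomain R] [Module.Free ℤ R] [Module.Finite ℤ R]
variable {p : ℕ} [Fact p.Prime]

/-- Distinct monic irreducible polynomials over `𝔽_p` of prescribed degrees `f P`, provided that at
most `p` indices share a degree, and at most one if this degree is divisible by `p`. -/
theorem exists_irreducible_family {ι : Type*} {T : Finset ι} {f : ι → ℕ}
    (hf : ∀ P ∈ T, 0 < f P) (hcard : ∀ d, (T.filter (f · = d)).card ≤ p)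
    (hcard' : ∀ d, p ∣ d → (T.filter (f · = d)).card ≤ 1) :
    ∃ g : ι → (ZMod p)[X], (∀ P ∈ T, (g P).Monic ∧ Irreducible (g P) ∧ (g P).natDegree = f P) ∧
      Set.InjOn g T := by
  have hcol : ∀ d, ∃ c : ι → ZMod p, Set.InjOn c (T.filter (f · = d) : Finset ι) := by
    intro d
    obtain ⟨c, -, hc⟩ := Set.Finite.exists_injOn_of_encard_le
      (s := ((T.filter (f · = d) : Finset ι) : Set ι)) (t := (Set.univ : Set (ZMod p)))
      (Finset.finite_toSet _) (by
        rw [Set.encard_coe_eq_coe_finsetCard, Set.encard_univ, ENat.card_eq_coe_fintype_card,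
          ZMod.card]
        exact_mod_cast hcard d)
    exact ⟨c, hc⟩
  choose c hc using hcol
  have hirr : ∀ d, ∃ g : (ZMod p)[X], d ≠ 0 → g.Monic ∧ Irreducible g ∧ g.natDegree = d := by
    intro d
    by_cases hd : d = 0
    · exact ⟨0, fun h ↦ (h hd).elim⟩
    · obtain ⟨g, hg⟩ := ZMod.exists_monic_irreducible_natDegree p hd
      exact ⟨g, fun _ ↦ hg⟩
  choose g hg using hirr
  refine ⟨fun P ↦ taylor (c (f P) P) (g (f P)), fun P hP ↦ ?_, fun P hP Q hQ h ↦ ?_⟩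
  · obtain ⟨h1, h2, h3⟩ := hg (f P) (hf P hP).ne'
    refine ⟨?_, irreducible_taylor h2 _, by rw [natDegree_taylor, h3]⟩
    rw [Monic, leadingCoeff_taylor]
    exact h1
  · obtain ⟨h1, h2, h3⟩ := hg (f P) (hf P hP).ne'
    obtain ⟨-, -, h3'⟩ := hg (f Q) (hf Q hQ).ne'
    have hPQ : f P = f Q := by
      have := congrArg natDegree h
      simpa only [natDegree_taylor, h3, h3'] using this
    have hPm : P ∈ T.filter (f · = f P) := Finset.mem_filter.2 ⟨hP, rfl⟩
    have hQm : Q ∈ T.filter (f · = f P) := Finset.mem_filter.2 ⟨hQ, hPQ.symm⟩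
    by_cases hpd : p ∣ f P
    · exact Finset.card_le_one.1 (hcard' _ hpd) P hPm Q hQm
    · refine hc (f P) (Finset.mem_coe.2 hPm) (Finset.mem_coe.2 hQm) ?_
      simp only [← hPQ] at h
      exact taylor_left_injective h1 (by rwa [h3]) h

/-- Under the counting condition on the residue degrees there is an element which generates
`R / pR`: every polynomial relation it satisfies mod `p` has degree at least the rank of `R`. -/
theorem exists_forall_aeval_mem_span_imp_dvd {T : Finset (Ideal R)} {e f : Ideal R → ℕ}
    (hT : ∀ P ∈ T, Prime P ∧ 0 < e P ∧ 0 < f P ∧ Ideal.absNorm P = p ^ f P ∧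
        emultiplicity P (Ideal.span {(p : R)}) = e P)
    (hsum : ∑ P ∈ T, e P * f P = Module.finrank ℤ R)
    (hcard : ∀ d, (T.filter (f · = d)).card ≤ p)
    (hcard' : ∀ d, p ∣ d → (T.filter (f · = d)).card ≤ 1) :
    ∃ (θ : R) (Q : (ZMod p)[X]), Q.natDegree = Module.finrank ℤ R ∧
      ∀ H : ℤ[X], aeval θ H ∈ Ideal.span {(p : R)} → Q ∣ H.map (Int.castRingHom (ZMod p)) := by
  obtain ⟨g, hg, hginj⟩ := exists_irreducible_family (p := p) (fun P hP ↦ (hT P hP).2.2.1)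
    hcard hcard'
  have hlift : ∀ P, ∃ G : ℤ[X], G.map (Int.castRingHom (ZMod p)) = g P := fun P ↦
    Polynomial.map_surjective _ ZMod.intCast_surjective (g P)
  choose G hG using hlift
  have hx : ∀ P : T, ∃ x : R, aeval x (G P) ∈ P.1 ∧ aeval x (G P) ∉ P.1 ^ 2 := by
    rintro ⟨P, hP⟩
    obtain ⟨h1, -, -, h4, -⟩ := hT P hP
    exact exists_aeval_mem_notMem_sq (p := p) h1 h4 (by rw [hG]; exact (hg P hP).2.1)
      (by rw [hG]; exact (hg P hP).2.2)
  choose x hxP hxP2 using hx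
  -- Congruence modulo P² is what preserves exact divisibility of G_P by P.
  obtain ⟨θ, hθ⟩ := IsDedekindDomain.exists_forall_sub_mem_ideal (s := T) (fun P ↦ P)
    (fun _ ↦ 2) (fun P hP ↦ (hT P hP).1) (fun _ _ _ _ h ↦ h) x
  refine ⟨θ, ∏ P ∈ T, g P ^ e P, ?_, ?_⟩
  · rw [natDegree_prod_of_monic _ _ fun P hP ↦ (hg P hP).1.pow _, ← hsum]
    refine Finset.sum_congr rfl fun P hP ↦ ?_
    rw [natDegree_pow, (hg P hP).2.2]
  · intro H hH
    refine Finset.prod_dvd_of_coprime (fun P hP Q hQ hPQ ↦ ?_) fun P hP ↦ ?_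
    · refine IsCoprime.pow ((hg P hP).2.1.coprime_iff_not_dvd.2 fun hd ↦ hPQ ?_)
      exact hginj hP hQ (eq_of_monic_of_associated (hg P hP).1 (hg Q hQ).1
        ((hg P hP).2.1.associated_of_dvd (hg Q hQ).2.1 hd))
    · obtain ⟨h1, -, -, h4, h5⟩ := hT P hP
      have hdiff : aeval θ (G P) - aeval (x ⟨P, hP⟩) (G P) ∈ P ^ 2 := by
        have := sub_dvd_eval_sub θ (x ⟨P, hP⟩) ((G P).map (algebraMap ℤ R))
        simp only [eval_map_algebraMap] at this
        exact Ideal.mem_of_dvd _ this (hθ P hP)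
      have hpe : Ideal.span {(p : R)} ≤ P ^ e P :=
        Ideal.le_of_dvd (pow_dvd_iff_le_emultiplicity.2 h5.ge)
      rw [← hG]
      refine map_pow_dvd_of_aeval_mem_pow h1 h4 (by rw [hG]; exact (hg P hP).2.1) (x := θ) ?_ ?_
        (hpe (Ideal.mem_span_singleton_self _)) (hpe hH)
      · have := P.add_mem (Ideal.pow_le_self two_ne_zero hdiff) (hxP ⟨P, hP⟩)
        simpa using this
      · intro h
        have := Ideal.sub_mem _ h hdiff
        rw [sub_sub_cancel] at this
        exact hxP2 ⟨P, hP⟩ this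

end MonogenicModP

/-! ### From a generator modulo p to an index prime to p. -/

namespace NumberField

variable {K : Type*} [Field K] [NumberField K]

lemma natDegree_minpoly_int (θ : 𝓞 K) :
    (minpoly ℤ θ).natDegree = (minpoly ℚ (θ : K)).natDegree := by
  rw [show (minpoly ℚ (θ : K)) = (minpoly ℤ θ).map (algebraMap ℤ ℚ) from
    minpoly.isIntegrallyClosed_eq_field_fractions ℚ K (RingOfIntegers.isIntegral θ),
    (minpoly.monic (RingOfIntegers.isIntegral θ)).natDegree_map]

/-- ℤ[θ] has full rank. This rules out the default value 0, making the quotient finite and the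
common divisors bounded. -/
lemma elementIndex_ne_zero {θ : 𝓞 K} (hθ : ℚ⟮(θ : K)⟯ = ⊤) : elementIndex K θ ≠ 0 := by
  have hint : IsIntegral ℤ θ := RingOfIntegers.isIntegral θ
  have hrank : Module.finrank ℤ (Subalgebra.toSubmodule (Algebra.adjoin ℤ {θ})) =
      Module.finrank ℤ (𝓞 K) := by
    have h1 : Module.finrank ℤ (Algebra.adjoin ℤ {θ}) = (minpoly ℤ θ).natDegree := by
      rw [(Algebra.adjoin.powerBasis' hint).finrank, Algebra.adjoin.powerBasis'_dim]
    rw [RingOfIntegers.rank K]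
    refine h1.trans ?_
    rw [natDegree_minpoly_int]
    exact (Field.primitive_element_iff_minpoly_natDegree_eq ℚ (θ : K)).1 hθ
  have hfin : Finite (𝓞 K ⧸ Subalgebra.toSubmodule (Algebra.adjoin ℤ {θ})) :=
    Submodule.finiteQuotientOfFreeOfRankEq _ hrank
  rw [elementIndex, AddSubgroup.index]
  exact Nat.card_ne_zero.2 ⟨inferInstance, hfin⟩

/-- If every relation of `θ` mod `p` has degree at least `[K : ℚ]`, then `θ` is a primitive element
whose index is prime to `p`. -/
theorem not_dvd_elementIndex {p : ℕ} (hp : p.Prime) {θ : 𝓞 K}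
    {Q : (ZMod p)[X]} (hdeg : Q.natDegree = Module.finrank ℤ (𝓞 K))
    (h : ∀ H : ℤ[X], aeval θ H ∈ Ideal.span {(p : 𝓞 K)} →
      Q ∣ H.map (Int.castRingHom (ZMod p))) :
    ℚ⟮(θ : K)⟯ = ⊤ ∧ ¬ p ∣ elementIndex K θ := by
  have : Fact p.Prime := ⟨hp⟩
  have hint : IsIntegral ℤ θ := RingOfIntegers.isIntegral θ
  have hmon := minpoly.monic hint
  have hle : Module.finrank ℤ (𝓞 K) ≤ (minpoly ℤ θ).natDegree := by
    have h1 := natDegree_le_of_dvd (h (minpoly ℤ θ) (by simp)) (hmon.map _).ne_zero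
    rwa [hmon.natDegree_map, hdeg] at h1
  have hgen : ℚ⟮(θ : K)⟯ = ⊤ := by
    rw [Field.primitive_element_iff_minpoly_natDegree_eq]
    refine le_antisymm (minpoly.natDegree_le _) ?_
    rwa [← natDegree_minpoly_int, ← RingOfIntegers.rank K]
  refine ⟨hgen, fun hdvd ↦ ?_⟩
  have h0 := elementIndex_ne_zero hgen
  set N := (Subalgebra.toSubmodule (Algebra.adjoin ℤ {θ})).toAddSubgroup with hN
  have hmemN : ∀ y : 𝓞 K, y ∈ N ↔ ∃ H : ℤ[X], aeval θ H = y := by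
    intro y
    change y ∈ Algebra.adjoin ℤ {θ} ↔ _
    rw [Algebra.adjoin_singleton_eq_range_aeval]
    rfl
  have hindex : elementIndex K θ = Nat.card (𝓞 K ⧸ N) := rfl
  rw [hindex] at h0 hdvd
  have : Finite (𝓞 K ⧸ N) := Nat.finite_of_card_ne_zero h0
  -- Cauchy's theorem gives y ∉ ℤ[θ] with py ∈ ℤ[θ].
  obtain ⟨z, hz⟩ := exists_prime_addOrderOf_dvd_card' p hdvd
  obtain ⟨y, rfl⟩ := QuotientAddGroup.mk_surjective z
  have hpy : (p : 𝓞 K) * y ∈ N := by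
    have := addOrderOf_nsmul_eq_zero (y : 𝓞 K ⧸ N)
    rw [hz, ← QuotientAddGroup.mk_nsmul, QuotientAddGroup.eq_zero_iff, nsmul_eq_mul] at this
    exact this
  have hy : y ∉ N := by
    intro hy
    rw [(QuotientAddGroup.eq_zero_iff y).2 hy, addOrderOf_zero] at hz
    exact hp.one_lt.ne hz
  obtain ⟨H₀, hH₀⟩ := (hmemN _).1 hpy
  -- Once deg H is below the rank, divisibility by Q forces H ≡ 0 mod p, so y ∈ ℤ[θ].
  set H := H₀ %ₘ minpoly ℤ θ with hH
  have hHθ : aeval θ H = p * y := by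
    rw [hH, aeval_modByMonic_eq_self_of_root (minpoly.aeval ℤ θ), hH₀]
  have hQH := h H (by rw [hHθ]; exact Ideal.mem_span_singleton.2 ⟨y, rfl⟩)
  have hH0 : H.map (Int.castRingHom (ZMod p)) = 0 := by
    by_contra hne
    have h1 := natDegree_le_of_dvd hQH hne
    have h2 : H.natDegree < (minpoly ℤ θ).natDegree :=
      natDegree_modByMonic_lt _ hmon (minpoly.ne_one ℤ θ)
    have h3 : (minpoly ℤ θ).natDegree ≤ Module.finrank ℤ (𝓞 K) := by
      rw [natDegree_minpoly_int, RingOfIntegers.rank K]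
      exact minpoly.natDegree_le _
    have h4 : (H.map (Int.castRingHom (ZMod p))).natDegree ≤ H.natDegree := natDegree_map_le
    omega
  obtain ⟨W, hW⟩ := C_natCast_dvd_of_map_eq_zero hH0
  refine hy ((hmemN y).2 ⟨W, ?_⟩)
  have hp0 : (p : 𝓞 K) ≠ 0 := Nat.cast_ne_zero.2 hp.ne_zero
  apply mul_left_cancel₀ hp0
  rw [← hHθ, hW]
  simp

/-- A prime `p` does not divide the index of `K` if it does not divide the index of some
primitive element. -/
lemma not_dvd_fieldIndex {p : ℕ} {θ : 𝓞 K} (hθ : ℚ⟮(θ : K)⟯ = ⊤)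
    (h : ¬ p ∣ elementIndex K θ) : ¬ p ∣ fieldIndex K := by
  intro hdvd
  have hmem : elementIndex K θ ∈ indexSet K := ⟨θ, hθ, rfl⟩
  have hsup : fieldIndex K ∈ {d : ℕ | ∀ n ∈ indexSet K, d ∣ n} := by
    -- `sSup` on ℕ is attained only for a nonempty bounded set; the nonzero index of θ is the bound.
    refine Nat.sSup_mem ⟨1, fun n _ ↦ one_dvd n⟩ ⟨elementIndex K θ, fun d hd ↦ ?_⟩
    exact Nat.le_of_dvd (Nat.pos_of_ne_zero (elementIndex_ne_zero hθ)) (hd _ hmem)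
  exact h (hdvd.trans (hsup _ hmem))

end NumberField

/-! ### Primes of degree one when p does not divide both a and b. -/

section TrinomialResidues

variable {R : Type*} [CommRing R] [IsDedekindDomain R] [Module.Free ℤ R] [Module.Finite ℤ R]
variable {p : ℕ} {a b : ℤ} {α : R} {T : Finset (Ideal R)} {f : Ideal R → ℕ}

/-- If the primes `P ∈ T` above `p` all satisfy `α ≡ r mod P`, then `p ^ #T ∣ r⁹ + a r + b`. -/
theorem pow_card_dvd_of_forall_sub_mem
    (hN : ∀ r : ℤ, Algebra.norm ℤ ((r : R) - α) = r ^ 9 + a * r + b)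
    (hT : ∀ P ∈ T, Prime P) (hf0 : ∀ P ∈ T, 0 < f P)
    (hf : ∀ P ∈ T, Ideal.absNorm P = p ^ f P) {r : ℤ}
    (hr : ∀ P ∈ T, (r : R) - α ∈ P) : (p : ℤ) ^ T.card ∣ r ^ 9 + a * r + b := by
  have h := pow_sum_dvd_norm (k := fun _ ↦ 1) hT hf (x := (r : R) - α)
    (fun P hP ↦ by simpa using hr P hP)
  rw [hN] at h
  refine dvd_trans ?_ h
  push_cast
  refine pow_dvd_pow _ ?_
  rw [Finset.card_eq_sum_ones]
  exact Finset.sum_le_sum fun P hP ↦ by simpa using Nat.succ_le_of_lt (hf0 P hP)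

/-- F(r + p) - F(r) ≡ pF'(r) mod p². -/
lemma dvd_derivative_of_sq_dvd (hp : p.Prime) {r : ℤ}
    (h₀ : (p : ℤ) ^ 2 ∣ r ^ 9 + a * r + b)
    (h₁ : (p : ℤ) ^ 2 ∣ (r + p) ^ 9 + a * (r + p) + b) : (p : ℤ) ∣ 9 * r ^ 8 + a := by
  have hp0 : (p : ℤ) ≠ 0 := Nat.cast_ne_zero.2 hp.ne_zero
  have h2 : (p : ℤ) ^ 2 ∣ p * (9 * r ^ 8 + a) := by
    have h3 : (p : ℤ) ^ 2 ∣ p ^ 2 * (36 * r ^ 7 + 84 * r ^ 6 * p + 126 * r ^ 5 * p ^ 2 +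
      126 * r ^ 4 * p ^ 3 + 84 * r ^ 3 * p ^ 4 + 36 * r ^ 2 * p ^ 5 + 9 * r * p ^ 6 + p ^ 7) :=
      dvd_mul_right _ _
    exact ((h₁.sub h₀).sub h3).trans (dvd_of_eq (by ring))
  rw [pow_two] at h2
  exact Int.dvd_of_mul_dvd_mul_left hp0 h2

/-- The second difference F(r + p) + F(r - p) - 2F(r) is 72p²r⁷ mod p³, and 72 = 2³·3² is prime to
p. -/
lemma dvd_of_cube_dvd (hp : p.Prime) (hp5 : 5 ≤ p) {r : ℤ}
    (h₀ : (p : ℤ) ^ 3 ∣ r ^ 9 + a * r + b)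
    (h₁ : (p : ℤ) ^ 3 ∣ (r + p) ^ 9 + a * (r + p) + b)
    (h₂ : (p : ℤ) ^ 3 ∣ (r - p) ^ 9 + a * (r - p) + b) : (p : ℤ) ∣ r := by
  have hp0 : (p : ℤ) ≠ 0 := Nat.cast_ne_zero.2 hp.ne_zero
  have hpp : Prime (p : ℤ) := Nat.prime_iff_prime_int.1 hp
  have h2 : (p : ℤ) ^ 2 * p ∣ p ^ 2 * (72 * r ^ 7) := by
    have h3 : (p : ℤ) ^ 3 ∣ p ^ 3 * (p * (252 * r ^ 5 + 168 * r ^ 3 * p ^ 2 + 18 * r * p ^ 4)) :=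
      dvd_mul_right _ _
    exact (((h₁.add h₂).sub (h₀.mul_left 2)).sub h3).trans (dvd_of_eq (by ring))
  have h4 := Int.dvd_of_mul_dvd_mul_left (pow_ne_zero 2 hp0) h2
  rcases hpp.dvd_or_dvd h4 with h | h
  · have h72 : p ∣ 2 ^ 3 * 3 ^ 2 := by exact_mod_cast h
    rcases (Nat.Prime.dvd_mul hp).1 h72 with h | h
    · have := Nat.le_of_dvd (by norm_num) (hp.dvd_of_dvd_pow h); omega
    · have := Nat.le_of_dvd (by norm_num) (hp.dvd_of_dvd_pow h); omega
  · exact hpp.dvd_of_dvd_pow h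

lemma exists_residue [Fact p.Prime] {P : Ideal R} (hP : Prime P)
    (hf : Ideal.absNorm P = p ^ 1) (x : R) :
    ∃ c : ZMod p, ∀ r : ℤ, (r : ZMod p) = c → (r : R) - x ∈ P := by
  have := Ideal.isPrime_of_prime hP
  have : Finite (R ⧸ P) := Ideal.finiteQuotientOfFreeOfNeBot P hP.ne_zero
  let := Fintype.ofFinite (R ⧸ P)
  have := charP_quotient_of_absNorm (p := p) hP hf
  have hbij : Function.Bijective (ZMod.castHom dvd_rfl (R ⧸ P) : ZMod p →+* R ⧸ P) := by
    rw [Fintype.bijective_iff_injective_and_card]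
    refine ⟨RingHom.injective _, ?_⟩
    rw [ZMod.card, ← Nat.card_eq_fintype_card, card_quotient_eq_absNorm, hf, pow_one]
  obtain ⟨c, hc⟩ := hbij.2 (Ideal.Quotient.mk P x)
  refine ⟨c, fun r hr ↦ ?_⟩
  rw [← Ideal.Quotient.eq, ← hc, ← hr]
  simp

/-- At most `p` primes of residue degree one lie above `p` if `x⁹ + a x + b` is not `x⁹` mod `p`. -/
theorem card_le_of_not_dvd (hp : p.Prime) (hp5 : 5 ≤ p)
    (hN : ∀ r : ℤ, Algebra.norm ℤ ((r : R) - α) = r ^ 9 + a * r + b)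
    (hab : ¬ ((p : ℤ) ∣ a ∧ (p : ℤ) ∣ b))
    (hT : ∀ P ∈ T, Prime P) (hf : ∀ P ∈ T, Ideal.absNorm P = p ^ 1) : T.card ≤ p := by
  classical
  have : Fact p.Prime := ⟨hp⟩
  have hpp : Prime (p : ℤ) := Nat.prime_iff_prime_int.1 hp
  have hres : ∀ P, ∃ c : ZMod p, P ∈ T → ∀ r : ℤ, (r : ZMod p) = c → (r : R) - α ∈ P := by
    intro P
    by_cases hP : P ∈ T
    · obtain ⟨c, hc⟩ := exists_residue (hT P hP) (hf P hP) α
      exact ⟨c, fun _ ↦ hc⟩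
    · exact ⟨0, fun h ↦ (hP h).elim⟩
  choose ρ hρ using hres
  let k : ZMod p → ℕ := fun c ↦ (T.filter (ρ · = c)).card
  have hk : ∀ r : ℤ, (p : ℤ) ^ k r ∣ r ^ 9 + a * r + b := by
    intro r
    refine pow_card_dvd_of_forall_sub_mem (f := fun _ ↦ 1) hN
      (fun P hP ↦ hT P (Finset.mem_filter.1 hP).1) (fun _ _ ↦ one_pos)
      (fun P hP ↦ hf P (Finset.mem_filter.1 hP).1) fun P hP ↦ ?_
    obtain ⟨h1, h2⟩ := Finset.mem_filter.1 hP
    exact hρ P h1 r h2.symm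
  have hadd : ∀ r : ℤ, ((r + p : ℤ) : ZMod p) = r := by intro r; simp
  have hsub : ∀ r : ℤ, ((r - p : ℤ) : ZMod p) = r := by intro r; simp
  have hder : ∀ r : ℤ, 2 ≤ k r → (p : ℤ) ∣ 9 * r ^ 8 + a := by
    intro r hr
    refine dvd_derivative_of_sq_dvd (b := b) hp ((pow_dvd_pow _ hr).trans (hk r)) ?_
    have := hk (r + p)
    rw [hadd] at this
    exact (pow_dvd_pow _ hr).trans this
  have hval : ∀ r : ℤ, 1 ≤ k r → (p : ℤ) ∣ r ^ 9 + a * r + b := fun r hr ↦ by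
    simpa using (pow_dvd_pow (p : ℤ) hr).trans (hk r)
  have hr0 : ∀ r : ℤ, 2 ≤ k r → ¬ (p : ℤ) ∣ r := by
    intro r hr hd
    have ha : (p : ℤ) ∣ a := (dvd_add_right ((dvd_pow hd (by norm_num)).mul_left 9)).1 (hder r hr)
    exact hab ⟨ha, (dvd_add_right (((dvd_pow hd (by norm_num))).add (ha.mul_right r))).1
      (hval r (by omega))⟩
  have h9 : ¬ (p : ℤ) ∣ 9 := by
    intro h
    have h' : p ∣ 3 ^ 2 := by exact_mod_cast h
    have := Nat.le_of_dvd (by norm_num) (hp.dvd_of_dvd_pow h')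
    omega
  have h8 : ¬ (p : ℤ) ∣ 8 := by
    intro h
    have h' : p ∣ 2 ^ 3 := by exact_mod_cast h
    have := Nat.le_of_dvd (by norm_num) (hp.dvd_of_dvd_pow h')
    omega
  have hpa : ∀ r : ℤ, 2 ≤ k r → ¬ (p : ℤ) ∣ a := by
    intro r hr ha
    have h1 := (dvd_add_left ha).1 (hder r hr)
    rcases hpp.dvd_or_dvd h1 with h | h
    · exact h9 h
    · exact hr0 r hr (hpp.dvd_of_dvd_pow h)
  -- 9F(r) - rF'(r) = 8ar + 9b is linear in r, so a double class is unique.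
  have hlin : ∀ r : ℤ, 2 ≤ k r → (p : ℤ) ∣ 8 * a * r + 9 * b := by
    intro r hr
    exact (((hval r (by omega)).mul_left 9).sub ((hder r hr).mul_left r)).trans (dvd_of_eq (by ring))
  have hle2 : ∀ r : ℤ, k r ≤ 2 := by
    intro r
    by_contra! hr
    have hr' : 3 ≤ k r := hr
    refine hr0 r (by omega) (dvd_of_cube_dvd (a := a) (b := b) hp hp5
      ((pow_dvd_pow _ hr').trans (hk r)) ?_ ?_)
    · have := hk (r + p)
      rw [hadd] at this
      exact (pow_dvd_pow _ hr').trans this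
    · have := hk (r - p)
      rw [hsub] at this
      exact (pow_dvd_pow _ hr').trans this
  have huniq : ∀ r s : ℤ, 2 ≤ k r → 2 ≤ k s → (r : ZMod p) = s := by
    intro r s hr hs
    have h1 : (p : ℤ) ∣ 8 * (a * (s - r)) := by
      exact ((hlin s hs).sub (hlin r hr)).trans (dvd_of_eq (by ring))
    have h2 := ((hpp.dvd_or_dvd h1).resolve_left h8)
    have h3 := (hpp.dvd_or_dvd h2).resolve_left (hpa r hr)
    exact (ZMod.intCast_eq_intCast_iff_dvd_sub _ _ _).2 h3
  have hcard : T.card = ∑ c : ZMod p, k c :=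
    Finset.card_eq_sum_card_fiberwise fun _ _ ↦ Finset.mem_coe.2 (Finset.mem_univ _)
  by_cases hex : ∃ r : ℤ, 2 ≤ k r
  · obtain ⟨r, hr⟩ := hex
    have hrz : (r : ZMod p) ≠ 0 := by
      rw [Ne, ZMod.intCast_zmod_eq_zero_iff_dvd]
      exact hr0 r hr
    have hk0 : k 0 = 0 := by
      by_contra h0
      have h1 : (p : ℤ) ∣ b := by
        simpa using hval 0 (by simpa using Nat.one_le_iff_ne_zero.2 h0)
      have h2 := (dvd_add_left (h1.mul_left 9)).1 (hlin r hr)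
      rw [mul_assoc] at h2
      rcases hpp.dvd_or_dvd ((hpp.dvd_or_dvd h2).resolve_left h8) with h | h
      · exact hpa r hr h
      · exact hr0 r hr h
    -- The empty class 0 compensates for the one double class; the indicators cancel on summing over
    -- c.
    have hbound : ∀ c : ZMod p, k c + (if c = 0 then 1 else 0) ≤ 1 + (if c = r then 1 else 0) := by
      intro c
      obtain ⟨s, rfl⟩ := ZMod.intCast_surjective c
      by_cases h0 : (s : ZMod p) = 0
      · rw [h0, hk0]; simp [hrz.symm]
      · rw [if_neg h0]
        by_cases hsr : (s : ZMod p) = r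
        · rw [if_pos hsr]; exact hle2 s
        · rw [if_neg hsr]
          by_contra! hgt
          exact hsr (huniq s r (by omega) hr)
    have hs := Finset.sum_le_sum fun c (_ : c ∈ (Finset.univ : Finset (ZMod p))) ↦ hbound c
    simp only [Finset.sum_add_distrib, Finset.sum_ite_eq', Finset.mem_univ, if_true,
      Finset.sum_const, Finset.card_univ, ZMod.card, smul_eq_mul, mul_one] at hs
    omega
  · push Not at hex
    rw [hcard]
    calc ∑ c : ZMod p, k c ≤ ∑ _c : ZMod p, 1 := Finset.sum_le_sum fun c _ ↦ by
          obtain ⟨s, rfl⟩ := ZMod.intCast_surjective c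
          have := hex s
          omega
      _ = p := by simp [ZMod.card]

end TrinomialResidues

/-! ### Newton polygon bound when p divides a and b. -/

section TrinomialNewton

variable {R : Type*} [CommRing R] [IsDedekindDomain R]

/-- Ultrametric principle: in a vanishing sum the minimal valuation is not attained by a single
term. -/
lemma emultiplicity_not_lt_of_add_eq_zero {P : Ideal R} {x y z : R} (h : x + y + z = 0) {k l m : ℕ}
    (hx : emultiplicity P (Ideal.span {x}) = k) (hy : (l : ℕ∞) ≤ emultiplicity P (Ideal.span {y}))
    (hz : (m : ℕ∞) ≤ emultiplicity P (Ideal.span {z})) (hl : k < l) (hm : k < m) : False := by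
  have hyP : y ∈ P ^ (k + 1) := Ideal.pow_le_pow_right hl
    (Ideal.dvd_span_singleton.1 (pow_dvd_of_le_emultiplicity hy))
  have hzP : z ∈ P ^ (k + 1) := Ideal.pow_le_pow_right hm
    (Ideal.dvd_span_singleton.1 (pow_dvd_of_le_emultiplicity hz))
  have hxP : x ∈ P ^ (k + 1) := by
    rw [show x = -(y + z) by linear_combination h]
    exact neg_mem (add_mem hyP hzP)
  have := le_emultiplicity_of_pow_dvd (Ideal.dvd_span_singleton.2 hxP)
  rw [hx] at this
  norm_cast at this
  omega

lemma le_emultiplicity_intCast {p : ℕ} {P : Ideal R} (hP : Prime P) {e : ℕ}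
    (he : emultiplicity P (Ideal.span {(p : R)}) = e) {c : ℤ} {m : ℕ} (hc : (p : ℤ) ^ m ∣ c) :
    ((m * e : ℕ) : ℕ∞) ≤ emultiplicity P (Ideal.span {(c : R)}) := by
  obtain ⟨d, rfl⟩ := hc
  push_cast
  rw [← Ideal.span_singleton_mul_span_singleton, emultiplicity_mul hP,
    ← Ideal.span_singleton_pow, emultiplicity_pow hP, he]
  exact le_self_add

/-- By Bézout, an integer prime to p lies in no prime above p. -/
lemma emultiplicity_intCast {p : ℕ} (hp : p.Prime) {P : Ideal R} (hP : Prime P) {e : ℕ}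
    (he0 : 0 < e) (he : emultiplicity P (Ideal.span {(p : R)}) = e) {c : ℤ} {m : ℕ}
    (hc : (p : ℤ) ^ m ∣ c) (hc' : ¬ (p : ℤ) ^ (m + 1) ∣ c) :
    emultiplicity P (Ideal.span {(c : R)}) = ((m * e : ℕ) : ℕ∞) := by
  obtain ⟨d, rfl⟩ := hc
  have hpd : ¬ (p : ℤ) ∣ d := fun h ↦ hc' (by rw [pow_succ]; exact mul_dvd_mul_left _ h)
  have hd : ¬ P ∣ Ideal.span {(d : R)} := by
    rw [Ideal.dvd_span_singleton]
    intro hdP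
    have hpP : (p : R) ∈ P := by
      rw [← Ideal.dvd_span_singleton, ← pow_one P]
      exact pow_dvd_of_le_emultiplicity (by rw [he]; exact_mod_cast he0)
    obtain ⟨s, t, hst⟩ :=
      ((Nat.prime_iff_prime_int.1 hp).irreducible.coprime_iff_not_dvd.2 hpd : IsCoprime (p : ℤ) d)
    have h1 : (1 : R) ∈ P := by
      have : (s : R) * p + t * d = 1 := by exact_mod_cast congrArg (Int.cast : ℤ → R) hst
      rw [← this]
      exact P.add_mem (P.mul_mem_left _ hpP) (P.mul_mem_left _ hdP)
    exact (Ideal.isPrime_of_prime hP).ne_top ((Ideal.eq_top_iff_one P).2 h1)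
  push_cast
  rw [← Ideal.span_singleton_mul_span_singleton, emultiplicity_mul hP,
    ← Ideal.span_singleton_pow, emultiplicity_pow hP, he, emultiplicity_eq_zero.2 hd, add_zero]

variable [Module.Free ℤ R] [Module.Finite ℤ R]

/-- At most five primes lie above `p` if `p ∣ a`, `p ∣ b` and `(a, b)` is reduced at `p`. -/
theorem card_le_five_of_dvd {p : ℕ} (hp : p.Prime) {a b : ℤ} {α : R} {T : Finset (Ideal R)}
    {e f : Ideal R → ℕ} (hb0 : b ≠ 0) (hα : α ^ 9 + a * α + b = 0)
    (hN : Algebra.norm ℤ α = -b) (hα0 : α ≠ 0)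
    (hT : ∀ P ∈ T, Prime P ∧ 0 < e P ∧ 0 < f P ∧ Ideal.absNorm P = p ^ f P ∧
        emultiplicity P (Ideal.span {(p : R)}) = e P)
    (hsum : ∑ P ∈ T, e P * f P = 9)
    (ha : (p : ℤ) ∣ a) (hb : (p : ℤ) ∣ b) (hred : ¬ ((p : ℤ) ^ 8 ∣ a ∧ (p : ℤ) ^ 9 ∣ b)) :
    T.card ≤ 5 := by
  have hpp : Prime (p : ℤ) := Nat.prime_iff_prime_int.1 hp
  have hexact : ∀ c : ℤ, c ≠ 0 → (p : ℤ) ∣ c →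
      ∃ m, 1 ≤ m ∧ (p : ℤ) ^ m ∣ c ∧ ¬ (p : ℤ) ^ (m + 1) ∣ c := by
    intro c hc hpc
    have hfin : FiniteMultiplicity (p : ℤ) c := FiniteMultiplicity.of_prime_left hpp hc
    refine ⟨multiplicity (p : ℤ) c, ?_, pow_multiplicity_dvd _ _,
      hfin.not_pow_dvd_of_multiplicity_lt (Nat.lt_succ_self _)⟩
    exact hfin.le_multiplicity_of_pow_dvd (by simpa using hpc)
  obtain ⟨m, hm1, hm, hm'⟩ := hexact b hb0 hb
  let w : Ideal R → ℕ := fun P ↦ multiplicity P (Ideal.span {α})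
  have hw : ∀ P ∈ T, emultiplicity P (Ideal.span {α}) = w P := fun P hP ↦
    (FiniteMultiplicity.of_prime_left (hT P hP).1 (by simpa using hα0)).emultiplicity_eq_multiplicity
  have hα9 : ∀ P ∈ T, emultiplicity P (Ideal.span {α ^ 9}) = ((9 * w P : ℕ) : ℕ∞) := by
    intro P hP
    rw [← Ideal.span_singleton_pow, emultiplicity_pow (hT P hP).1, hw P hP]
    push_cast
    rfl
  have hbP : ∀ P ∈ T, emultiplicity P (Ideal.span {(b : R)}) = ((m * e P : ℕ) : ℕ∞) := fun P hP ↦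
    emultiplicity_intCast hp (hT P hP).1 (hT P hP).2.1 (hT P hP).2.2.2.2 hm hm'
  have haP : ∀ n, (p : ℤ) ^ n ∣ a → ∀ P ∈ T,
      ((n * e P + w P : ℕ) : ℕ∞) ≤ emultiplicity P (Ideal.span {(a : R) * α}) := by
    intro n hn P hP
    rw [← Ideal.span_singleton_mul_span_singleton, emultiplicity_mul (hT P hP).1, hw P hP]
    push_cast
    gcongr
    exact_mod_cast le_emultiplicity_intCast (hT P hP).1 (hT P hP).2.2.2.2 hn
  have hx : ∀ n, (p : ℤ) ^ n ∣ a → ∀ P ∈ T, ¬ (9 * w P < n * e P + w P ∧ 9 * w P < m * e P) :=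
    fun n hn P hP h ↦ emultiplicity_not_lt_of_add_eq_zero hα (hα9 P hP) (haP n hn P hP)
      (hbP P hP).ge h.1 h.2
  have hz : ∀ n, (p : ℤ) ^ n ∣ a → ∀ P ∈ T, ¬ (m * e P < 9 * w P ∧ m * e P < n * e P + w P) :=
    fun n hn P hP h ↦ emultiplicity_not_lt_of_add_eq_zero
      (show (b : R) + α ^ 9 + a * α = 0 by linear_combination hα) (hbP P hP) (hα9 P hP).ge
      (haP n hn P hP) h.1 h.2
  -- One-sided polygon, of slope m/9. Quantifying over n also covers a = 0.
  by_cases hcase : ∃ n, (p : ℤ) ^ n ∣ a ∧ 8 * m ≤ 9 * n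
  · obtain ⟨n, hn, hmn⟩ := hcase
    have hm9 : m < 9 := by
      by_contra! h9
      exact hred ⟨(pow_dvd_pow _ (by omega)).trans hn, (pow_dvd_pow _ h9).trans hm⟩
    have h3 : ∀ P ∈ T, 3 ≤ e P := by
      intro P hP
      have h1 := hx n hn P hP
      have h2 := hz n hn P hP
      have he := (hT P hP).2.1
      have hMN : 8 * (m * e P) ≤ 9 * (n * e P) := by nlinarith
      -- Since 1 ≤ m ≤ 8, this gives 3 ∣ e.
      have heq : 9 * w P = m * e P := by omega
      clear * - heq hm1 hm9 he
      interval_cases m <;> omega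
    have : ∑ P ∈ T, 3 ≤ 9 := by
      rw [← hsum]
      refine Finset.sum_le_sum fun P hP ↦ ?_
      have := h3 P hP
      have := (hT P hP).2.2.1
      nlinarith
    simp only [Finset.sum_const, smul_eq_mul] at this
    omega
  · push Not at hcase
    have ha0 : a ≠ 0 := by
      rintro rfl
      have := hcase m (dvd_zero _)
      omega
    obtain ⟨n, hn1, hn, hn'⟩ := hexact a ha0 ha
    have hmn := hcase n hn
    have hn8 : n < 8 := by
      by_contra! h8
      exact hred ⟨(pow_dvd_pow _ h8).trans hn, (pow_dvd_pow _ (by omega)).trans hm⟩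
    -- Two sides: valuation (m - n)e on a side of length 1, or ne/8 on a side of length 8.
    have hdich : ∀ P ∈ T, w P + n * e P = m * e P ∨ 8 * w P = n * e P := by
      intro P hP
      have h1 := hx n hn P hP
      have h2 := hz n hn P hP
      have h3 : ¬ (n * e P + w P < 9 * w P ∧ n * e P + w P < m * e P) := fun h ↦ by
        refine emultiplicity_not_lt_of_add_eq_zero
          (show (a : R) * α + α ^ 9 + b = 0 by linear_combination hα) (k := n * e P + w P) ?_
          (hα9 P hP).ge (hbP P hP).ge h.1 h.2
        rw [← Ideal.span_singleton_mul_span_singleton, emultiplicity_mul (hT P hP).1, hw P hP,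
          emultiplicity_intCast hp (hT P hP).1 (hT P hP).2.1 (hT P hP).2.2.2.2 hn hn']
        push_cast
        rfl
      have he := (hT P hP).2.1
      have hMN : 9 * (n * e P) < 8 * (m * e P) := by nlinarith
      omega
    have hwf : ∑ P ∈ T, w P * f P ≤ m := by
      have h := pow_sum_dvd_norm (k := w) (fun P hP ↦ (hT P hP).1)
        (fun P hP ↦ (hT P hP).2.2.2.1) (x := α)
        (fun P hP ↦ Ideal.dvd_span_singleton.1 (pow_multiplicity_dvd _ _))
      rw [hN, dvd_neg] at h
      push_cast at h
      by_contra! hlt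
      exact hm' ((pow_dvd_pow _ hlt).trans h)
    classical
    let S₁ := T.filter fun P ↦ w P + n * e P = m * e P
    let S₂ := T.filter fun P ↦ ¬ w P + n * e P = m * e P
    have hS : ∀ F : Ideal R → ℕ, ∑ P ∈ S₁, F P + ∑ P ∈ S₂, F P = ∑ P ∈ T, F P := fun F ↦
      Finset.sum_filter_add_sum_filter_not T _ F
    have hS₁ : ∑ P ∈ S₁, w P * f P + n * ∑ P ∈ S₁, e P * f P = m * ∑ P ∈ S₁, e P * f P := by
      rw [Finset.mul_sum, Finset.mul_sum, ← Finset.sum_add_distrib]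
      refine Finset.sum_congr rfl fun P hP ↦ ?_
      linear_combination (f P) * (Finset.mem_filter.1 hP).2
    have hS₂e : ∀ P ∈ S₂, 8 * w P = n * e P := fun P hP ↦
      (hdich P (Finset.mem_filter.1 hP).1).resolve_left (Finset.mem_filter.1 hP).2
    have hS₂ : 8 * ∑ P ∈ S₂, w P * f P = n * ∑ P ∈ S₂, e P * f P := by
      rw [Finset.mul_sum, Finset.mul_sum]
      refine Finset.sum_congr rfl fun P hP ↦ ?_
      linear_combination (f P) * hS₂e P hP
    have hE := hS fun P ↦ e P * f P
    have hW := hS fun P ↦ w P * f P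
    have hc₁ : S₁.card ≤ ∑ P ∈ S₁, e P * f P := by
      rw [Finset.card_eq_sum_ones]
      refine Finset.sum_le_sum fun P hP ↦ ?_
      have h := hT P (Finset.mem_filter.1 hP).1
      exact Nat.mul_pos h.2.1 h.2.2.1
    have hc₂ : S₂.card * 2 ≤ ∑ P ∈ S₂, e P * f P := by
      rw [← smul_eq_mul, ← Finset.sum_const]
      refine Finset.sum_le_sum fun P hP ↦ ?_
      obtain ⟨-, he, hf, -⟩ := hT P (Finset.mem_filter.1 hP).1
      have h8 := hS₂e P hP
      have h2 : 2 ≤ e P := by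
        clear * - h8 hn1 hn8 he
        interval_cases n <;> omega
      nlinarith
    have hcard : S₁.card + S₂.card = T.card := Finset.card_filter_add_card_filter_not _
    -- The two slope identities and ∑ w f ≤ m combine to (E₁ - 1)(8m - 9n) ≤ 0, with 8m > 9n.
    have hE₁ : ∑ P ∈ S₁, e P * f P ≤ 1 := by
      set E₁ := ∑ P ∈ S₁, e P * f P
      set E₂ := ∑ P ∈ S₂, e P * f P
      set W₁ := ∑ P ∈ S₁, w P * f P
      set W₂ := ∑ P ∈ S₂, w P * f P
      by_contra! hlt
      have hE₂ : (E₂ : ℤ) = 9 - E₁ := by omega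
      have hS₁' : (W₁ : ℤ) + n * E₁ = m * E₁ := by exact_mod_cast hS₁
      have hS₂' : (8 : ℤ) * W₂ = n * E₂ := by exact_mod_cast hS₂
      have hle : (8 : ℤ) * (W₁ + W₂) ≤ 8 * m := by omega
      have hmn' : (9 : ℤ) * n < 8 * m := by exact_mod_cast hmn
      have hlt' : (1 : ℤ) < E₁ := by exact_mod_cast hlt
      rw [hE₂] at hS₂'
      nlinarith
    omega

end TrinomialNewton

/-! ### Norms in the trinomial field and descent from α to α/p. -/

namespace NumberField

variable {K : Type*} [Field K] [NumberField K]

/-- The norm of `r - α` is the value at `r` of the characteristic polynomial of `α`. -/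
theorem norm_intCast_sub_of_irreducible {a b : ℤ}
    (hirr : Irreducible (X ^ 9 + C a * X + C b : ℤ[X])) {α : 𝓞 K}
    (hroot : aeval (α : K) (X ^ 9 + C a * X + C b : ℤ[X]) = 0) (hgen : ℚ⟮(α : K)⟯ = ⊤) :
    Module.finrank ℚ K = 9 ∧
      ∀ r : ℤ, Algebra.norm ℤ ((r : 𝓞 K) - α) = r ^ 9 + a * r + b := by
  set F : ℤ[X] := X ^ 9 + C a * X + C b with hF
  have hmon : F.Monic := by rw [hF]; monicity!
  have hdeg : F.natDegree = 9 := by rw [hF]; compute_degree!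
  have hmin : minpoly ℚ (α : K) = F.map (algebraMap ℤ ℚ) := by
    refine (minpoly.eq_of_irreducible_of_monic
      ((hmon.irreducible_iff_irreducible_map_fraction_map (K := ℚ)).1 hirr) ?_ (hmon.map _)).symm
    rw [aeval_map_algebraMap, hroot]
  have hrank : Module.finrank ℚ K = 9 := by
    rw [← (Field.primitive_element_iff_minpoly_natDegree_eq ℚ (α : K)).1 hgen, hmin,
      hmon.natDegree_map, hdeg]
  refine ⟨hrank, fun r ↦ ?_⟩
  have hchar : (Algebra.lmul ℚ K (α : K)).charpoly = F.map (algebraMap ℤ ℚ) := by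
    have hd : minpoly ℚ (α : K) ∣ (Algebra.lmul ℚ K (α : K)).charpoly :=
      minpoly.dvd _ _ (Algebra.aeval_self_charpoly_lmul _)
    rw [← hmin]
    refine eq_of_monic_of_dvd_of_natDegree_le
      (minpoly.monic (Algebra.IsIntegral.isIntegral _)) (LinearMap.charpoly_monic _) hd ?_
    rw [LinearMap.charpoly_natDegree, hrank, hmin, hmon.natDegree_map, hdeg]
  have h1 := LinearMap.eval_charpoly (Algebra.lmul ℚ K (α : K)) (r : ℚ)
  rw [hchar] at h1
  have h2 : algebraMap ℚ (Module.End ℚ K) (r : ℚ) - Algebra.lmul ℚ K (α : K) =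
      Algebra.lmul ℚ K ((r : K) - α) := by
    ext x
    simp
  rw [h2] at h1
  have h3 : ((Algebra.norm ℤ ((r : 𝓞 K) - α) : ℤ) : ℚ) = Algebra.norm ℚ ((r : K) - (α : K)) := by
    rw [Algebra.coe_norm_int]
    simp
  have h4 : ((r ^ 9 + a * r + b : ℤ) : ℚ) = (F.map (algebraMap ℤ ℚ)).eval (r : ℚ) := by
    simp [hF]
  have h5 : ((Algebra.norm ℤ ((r : 𝓞 K) - α) : ℤ) : ℚ) = ((r ^ 9 + a * r + b : ℤ) : ℚ) := by
    rw [h3, h4, h1]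
    rfl
  exact_mod_cast h5

/-- At most `p` primes of residue degree one lie above `p`. -/
theorem card_filter_eq_one_le {p : ℕ} (hp : p.Prime) (hp5 : 5 ≤ p)
    (hrank : Module.finrank ℤ (𝓞 K) = 9)
    {T : Finset (Ideal (𝓞 K))} {e f : Ideal (𝓞 K) → ℕ}
    (hT : ∀ P ∈ T, Prime P ∧ 0 < e P ∧ 0 < f P ∧ Ideal.absNorm P = p ^ f P ∧
        emultiplicity P (Ideal.span {(p : 𝓞 K)}) = e P)
    (hsum : ∑ P ∈ T, e P * f P = 9) {a b : ℤ} {α : 𝓞 K} (hb0 : b ≠ 0)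
    (hα : α ^ 9 + a * α + b = 0)
    (hN : ∀ r : ℤ, Algebra.norm ℤ ((r : 𝓞 K) - α) = r ^ 9 + a * r + b) :
    (T.filter (f · = 1)).card ≤ p := by
  -- Passing to α/p replaces b by b/p⁹, so |b| drops.
  induction h : b.natAbs using Nat.strong_induction_on generalizing a b α with
  | _ n ih =>
  subst h
  by_cases hab : (p : ℤ) ∣ a ∧ (p : ℤ) ∣ b
  swap
  · refine card_le_of_not_dvd hp hp5 hN hab (fun P hP ↦ (hT P (Finset.mem_filter.1 hP).1).1)
      fun P hP ↦ ?_
    obtain ⟨h1, h2⟩ := Finset.mem_filter.1 hP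
    rw [(hT P h1).2.2.2.1, h2]
  have hα0 : α ≠ 0 := by
    rintro rfl
    apply hb0
    have : (b : 𝓞 K) = 0 := by simpa using hα
    exact_mod_cast this
  by_cases hred : (p : ℤ) ^ 8 ∣ a ∧ (p : ℤ) ^ 9 ∣ b
  swap
  · have hNα : Algebra.norm ℤ α = -b := by
      have h0 := hN 0
      have h1 : Algebra.norm ℤ (-α) = (-1) ^ 9 * Algebra.norm ℤ α := by
        have := Algebra.norm_algebraMap (R := ℤ) (S := 𝓞 K) (-1)
        rw [hrank] at this
        rw [← this, ← map_mul]
        simp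
      rw [Int.cast_zero, zero_sub, h1] at h0
      linear_combination -h0
    exact (Finset.card_filter_le _ _).trans
      ((card_le_five_of_dvd hp hb0 hα hNα hα0 hT hsum hab.1 hab.2 hred).trans hp5)
  obtain ⟨⟨a', rfl⟩, ⟨b', rfl⟩⟩ := hred
  have hpK : (p : K) ≠ 0 := Nat.cast_ne_zero.2 hp.ne_zero
  have hpZ : (p : ℤ) ≠ 0 := Nat.cast_ne_zero.2 hp.ne_zero
  have hpR : (p : 𝓞 K) ≠ 0 := Nat.cast_ne_zero.2 hp.ne_zero
  have hαK : (α : K) ^ 9 + p ^ 8 * a' * α + p ^ 9 * b' = 0 := by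
    have := congrArg (algebraMap (𝓞 K) K) hα
    simpa using this
  have hint : IsIntegral ℤ ((α : K) / p) := by
    refine ⟨X ^ 9 + C a' * X + C b', by monicity!, ?_⟩
    simp only [eval₂_add, eval₂_mul, eval₂_pow, eval₂_X, eval₂_C]
    simp only [eq_intCast]
    field_simp
    linear_combination hαK
  obtain ⟨β, hβ⟩ : ∃ β : 𝓞 K, α = p * β := by
    obtain ⟨β, hβ⟩ := (IsIntegralClosure.isIntegral_iff (A := 𝓞 K)).1 hint
    refine ⟨β, FaithfulSMul.algebraMap_injective (𝓞 K) K ?_⟩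
    rw [map_mul, map_natCast, hβ, mul_div_cancel₀ _ hpK]
  have hb0' : b' ≠ 0 := by
    rintro rfl
    simp at hb0
  refine ih b'.natAbs ?_ (a := a') (b := b') (α := β) hb0' ?_ ?_ rfl
  · rw [Int.natAbs_mul, Int.natAbs_pow, Int.natAbs_natCast]
    exact lt_mul_of_one_lt_left (Int.natAbs_pos.2 hb0') (Nat.one_lt_pow (by norm_num) hp.one_lt)
  · apply mul_left_cancel₀ (pow_ne_zero 9 hpR)
    rw [hβ] at hα
    push_cast at hα
    linear_combination hα
  · intro r
    have h1 := hN (p * r)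
    have h2 := Algebra.norm_algebraMap (R := ℤ) (S := 𝓞 K) (p : ℤ)
    rw [hrank] at h2
    have h3 : ((p * r : ℤ) : 𝓞 K) - α = algebraMap ℤ (𝓞 K) (p : ℤ) * ((r : 𝓞 K) - β) := by
      rw [hβ]
      simp [mul_sub]
    rw [h3, map_mul, h2] at h1
    apply mul_left_cancel₀ (pow_ne_zero 9 hpZ)
    linear_combination h1

end NumberField

/-! ### Counting primes of each residue degree. -/

theorem theorem4 (p : ℕ) (hp : p.Prime) (hp5 : 5 ≤ p) (a b : ℤ)
    (hirr : Irreducible (X ^ 9 + C a * X + C b : ℤ[X]))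
    (K : Type*) [Field K] [NumberField K] (α : K)
    (hroot : aeval α (X ^ 9 + C a * X + C b : ℤ[X]) = 0) (hgen : ℚ⟮α⟯ = ⊤) :
    ¬ p ∣ NumberField.fieldIndex K := by
  have : Fact p.Prime := ⟨hp⟩
  obtain ⟨α, rfl⟩ : ∃ β : NumberField.RingOfIntegers K, (β : K) = α :=
    ⟨⟨α, X ^ 9 + C a * X + C b, by monicity!, hroot⟩, rfl⟩
  obtain ⟨hrank, hN⟩ := NumberField.norm_intCast_sub_of_irreducible hirr hroot hgen
  rw [← NumberField.RingOfIntegers.rank] at hrank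
  have hα : α ^ 9 + a * α + b = 0 := by
    apply NumberField.RingOfIntegers.ext
    simpa using hroot
  have hb0 : b ≠ 0 := by
    rintro rfl
    have hX : (X ^ 9 + C a * X + C 0 : ℤ[X]) = X * (X ^ 8 + C a) := by
      rw [C_0]; ring
    rw [hX] at hirr
    have hdeg : (X ^ 8 + C a : ℤ[X]).natDegree = 8 := by compute_degree!
    rcases hirr.isUnit_or_isUnit rfl with h | h
    · exact not_isUnit_X h
    · rw [natDegree_eq_zero_of_isUnit h] at hdeg
      omega
  obtain ⟨T, e, f, hT, -, hsum⟩ :=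
    exists_factorization_span_prime (NumberField.RingOfIntegers K) hp
  have hsum9 := hsum.trans hrank
  have hmul : ∀ d, (T.filter (f · = d)).card * d ≤ 9 := by
    intro d
    rw [← hsum9, ← smul_eq_mul, ← Finset.sum_const]
    refine (Finset.sum_le_sum fun P hP ↦ ?_).trans
      (Finset.sum_le_sum_of_subset (Finset.filter_subset (f · = d) T))
    obtain ⟨h1, h2⟩ := Finset.mem_filter.1 hP
    rw [h2]
    exact Nat.le_mul_of_pos_left d (hT P h1).2.1
  have hzero : (T.filter (f · = 0)).card = 0 := by
    rw [Finset.card_eq_zero, Finset.filter_eq_empty_iff]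
    exact fun P hP ↦ (hT P hP).2.2.1.ne'
  have hcard : ∀ d, (T.filter (f · = d)).card ≤ p := by
    intro d
    rcases Nat.lt_trichotomy d 1 with h | rfl | h
    · obtain rfl : d = 0 := by omega
      omega
    · exact NumberField.card_filter_eq_one_le hp hp5 hrank hT hsum9 hb0 hα hN
    -- For d ≥ 2 at most 9/2, hence four, primes have degree d.
    · have := hmul d
      nlinarith
  have hcard' : ∀ d, p ∣ d → (T.filter (f · = d)).card ≤ 1 := by
    intro d hd
    rcases Nat.eq_zero_or_pos d with rfl | h
    · omega
    -- Here d ≥ p ≥ 5, and two such primes would need 2d ≤ 9.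
    · have h5 := Nat.le_of_dvd h hd
      have := hmul d
      nlinarith
  obtain ⟨θ, Q, hQ, hθ⟩ := exists_forall_aeval_mem_span_imp_dvd hT hsum hcard hcard'
  obtain ⟨h1, h2⟩ := NumberField.not_dvd_elementIndex hp hQ hθ
  exact NumberField.not_dvd_fieldIndex h1 h2
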